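/- \textbf{Theorem (blow-up for the first Painlevé equation).} There is a constant $c_u>0$ such that the following holds. Consider $u''=6u^2+t$ (with $'=d/dt$), and let $t_0\in\mathbb{R}$ be an initial time. If $u_0\in\mathbb{R}$ is sufficiently large (that is, $u_0>R$ for some $R=R(t_0)$), then for every $v_0\in\mathbb{R}$ the unique real solution $u$ with $u(t_0)=u_0$, $u'(t_0)=v_0$, continued forward in time as far as possible, has a finite maximal existence time $t_{\max}\in(t_0,\infty)$ (depending on the initial data $t_0,u_0,v_0$) and blows up there: $u(t)\to+\infty$ as $t\to t_{\max}-0$, and \[ u(t)\sim c_u\,(t_{\max}-t)^{-2}\qquad\text{as } t\to t_{\max}-0, \] that is, $u(t)\,(t_{\max}-t)^{2}\to c_u$ as $t\to t_{\max}-0$. -/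

import Mathlib

open Filter Topology Asymptotics Set

/-- `u` is a solution on `[t₀, T)`, with `t₀ < T`, of the first Painlevé equation
`u'' = 6 u² + t` with initial data `u(t₀) = u₀`, `u'(t₀) = v₀`; the function `v` is the derivative
of `u` on `[t₀, T)` (derivatives are one-sided at the left endpoint `t₀`). -/
def IsPainleveOneSolution (t₀ u₀ v₀ T : ℝ) (u : ℝ → ℝ) : Prop :=
  t₀ < T ∧ u t₀ = u₀ ∧
    ∃ v : ℝ → ℝ, v t₀ = v₀ ∧
      ∀ t ∈ Ico t₀ T,
        HasDerivWithinAt u (v t) (Ico t₀ T) t ∧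
        HasDerivWithinAt v (6 * u t ^ 2 + t) (Ico t₀ T) t

/-- `u` on `[t₀, tmax)` is the maximal forward solution of the initial value problem:
it is a solution on `[t₀, tmax)`, and every solution of the same problem on some `[t₀, T)` is a
restriction of it. In particular no solution exists on a longer interval. -/
def IsMaximalPainleveOneSolution (t₀ u₀ v₀ tmax : ℝ) (u : ℝ → ℝ) : Prop :=
  IsPainleveOneSolution t₀ u₀ v₀ tmax u ∧
    ∀ (T : ℝ) (w : ℝ → ℝ), IsPainleveOneSolution t₀ u₀ v₀ T w →
      T ≤ tmax ∧ EqOn w u (Ico t₀ T)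

/-!
Forward in time the equation `u'' = 6 u² + t` forces every real solution to blow up, whatever the
initial data, so any threshold for `u₀` will do; the constant `c_u` is `1`.

Since the right-hand side is a smooth vector field, solutions of one initial value problem agree
where they coexist, and they glue to a single pair `(u, u')` on a maximal interval
(`exists_common_painleveOnePair`). A solution with finite limits of `u` and `u'` at the end of its
interval can be continued (`IsPainleveOnePair.exists_extension`).

*The maximal interval is bounded* (`not_forall_isPainleveOnePair`). If not, `u'' ≥ t` makes `u'` and
`u` tend to `+∞`. The energy `E = u'² - 4 u³` satisfies `E' = 2 t u' ≥ 0` eventually, hence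
`u'² ≥ u³` eventually, so `u^(-1/2)` is positive with derivative at most `-1/2`, which is absurd.

*At the end `b` of the interval, `u` and `u'` tend to `+∞`*
(`IsPainleveOnePair.tendsto_atTop_of_not_extension`). As `u''` is bounded below on `[t₀, b)`, `u'` has
a limit in `(-∞, +∞]`, and then so has `u`; on a bounded interval the two are finite together, which
continuation excludes.

*The rate* (`IsPainleveOnePair.isEquivalent_of_tendsto_atTop`). Near `b` the energy satisfies
`|E'| ≤ 2 M u'`, so `E = O(u)` and `u'² / u³ → 4`. Thus `(u^(-1/2))' → -1`, and l'Hôpital's rule gives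
`u^(-1/2) ~ b - t`.
-/

/-! ### Existence and uniqueness -/

/-- The pair `(u, v)` solves the first-order system `u' = v`, `v' = 6 u² + t` on `[a, b)`, with
a one-sided derivative at `a`. -/
def IsPainleveOnePair (a b : ℝ) (u v : ℝ → ℝ) : Prop :=
  ∀ t ∈ Ico a b,
    HasDerivWithinAt u (v t) (Ico a b) t ∧ HasDerivWithinAt v (6 * u t ^ 2 + t) (Ico a b) t

/-- The first Painlevé equation as an autonomous vector field in the variables `(t, u, u')`. -/
def painleveOneField (p : ℝ × ℝ × ℝ) : ℝ × ℝ × ℝ := (1, p.2.2, 6 * p.2.1 ^ 2 + p.1)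

lemma contDiff_painleveOneField : ContDiff ℝ 1 painleveOneField := by
  unfold painleveOneField
  fun_prop

lemma Ico_mem_nhdsWithin_Ici_of_mem {a b t : ℝ} (ht : t ∈ Ico a b) : Ico a b ∈ 𝓝[Ici t] t :=
  mem_of_superset (Ico_mem_nhdsGE ht.2) (Ico_subset_Ico_left ht.1)

namespace IsPainleveOnePair

variable {a b c : ℝ} {u v w z : ℝ → ℝ}

lemma mono (h : IsPainleveOnePair a b u v) (hc : c ≤ b) : IsPainleveOnePair a c u v :=
  fun t ht ↦
    have ht' : t ∈ Ico a b := ⟨ht.1, ht.2.trans_le hc⟩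
    ⟨(h t ht').1.mono (Ico_subset_Ico_right hc), (h t ht').2.mono (Ico_subset_Ico_right hc)⟩

lemma hasDerivAt (h : IsPainleveOnePair a b u v) {t : ℝ} (ht : t ∈ Ioo a b) :
    HasDerivAt u (v t) t ∧ HasDerivAt v (6 * u t ^ 2 + t) t :=
  have ht' := Ioo_subset_Ico_self ht
  ⟨(h t ht').1.hasDerivAt (Ico_mem_nhds ht.1 ht.2), (h t ht').2.hasDerivAt (Ico_mem_nhds ht.1 ht.2)⟩

lemma hasDerivWithinAt_field (h : IsPainleveOnePair a b u v) {t : ℝ} (ht : t ∈ Ico a b) :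
    HasDerivWithinAt (fun s ↦ (s, u s, v s)) (painleveOneField (t, u t, v t)) (Ico a b) t :=
  (hasDerivWithinAt_id t _).prodMk ((h t ht).1.prodMk (h t ht).2)

/-- Uniqueness: on a compact interval both solutions stay in a compact set, where the field is
Lipschitz, so Grönwall's inequality applies. -/
lemma eqOn (h : IsPainleveOnePair a b u v) (h' : IsPainleveOnePair a b w z)
    (hu : u a = w a) (hv : v a = z a) : ∀ t ∈ Ico a b, u t = w t ∧ v t = z t := by
  intro t ht
  have hsub : Icc a t ⊆ Ico a b := fun s hs ↦ ⟨hs.1, hs.2.trans_lt ht.2⟩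
  have hc₁ : ContinuousOn (fun s ↦ (s, u s, v s)) (Icc a t) := fun s hs ↦
    (h.hasDerivWithinAt_field (hsub hs)).continuousWithinAt.mono hsub
  have hc₂ : ContinuousOn (fun s ↦ (s, w s, z s)) (Icc a t) := fun s hs ↦
    (h'.hasDerivWithinAt_field (hsub hs)).continuousWithinAt.mono hsub
  have hK := (isCompact_Icc.image_of_continuousOn hc₁).union
    (isCompact_Icc.image_of_continuousOn hc₂)
  obtain ⟨K, hLip⟩ := LocallyLipschitzOn.exists_lipschitzOnWith_of_compact hK
    contDiff_painleveOneField.locallyLipschitz.locallyLipschitzOn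
  have key := ODE_solution_unique_of_mem_Icc_right (v := fun _ ↦ painleveOneField)
    (fun _ _ ↦ hLip) hc₁
    (fun s hs ↦ (h.hasDerivWithinAt_field (hsub (Ico_subset_Icc_self hs))).mono_of_mem_nhdsWithin
      (Ico_mem_nhdsWithin_Ici_of_mem (hsub (Ico_subset_Icc_self hs))))
    (fun s hs ↦ Or.inl (mem_image_of_mem _ (Ico_subset_Icc_self hs))) hc₂
    (fun s hs ↦ (h'.hasDerivWithinAt_field (hsub (Ico_subset_Icc_self hs))).mono_of_mem_nhdsWithin
      (Ico_mem_nhdsWithin_Ici_of_mem (hsub (Ico_subset_Icc_self hs))))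
    (fun s hs ↦ Or.inr (mem_image_of_mem _ (Ico_subset_Icc_self hs)))
    (by simp only [hu, hv])
  simpa using key (right_mem_Icc.2 ht.1)

end IsPainleveOnePair

/-- Local existence, on both sides of the initial time. -/
lemma exists_painleveOne_local (t₁ U V : ℝ) :
    ∃ ε > (0 : ℝ), ∃ u v : ℝ → ℝ, u t₁ = U ∧ v t₁ = V ∧ ∀ t ∈ Ioo (t₁ - ε) (t₁ + ε),
      HasDerivAt u (v t) t ∧ HasDerivAt v (6 * u t ^ 2 + t) t := by
  obtain ⟨α, h₀, ε, hε, hα⟩ :=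
    ContDiffAt.exists_forall_mem_closedBall_exists_eq_forall_mem_Ioo_hasDerivAt₀
      (contDiff_painleveOneField.contDiffAt (x := (t₁, U, V))) t₁
  have h1 (t) (ht : t ∈ Ioo (t₁ - ε) (t₁ + ε)) : HasDerivAt (fun s ↦ (α s).1) 1 t := by
    have := (hasFDerivAt_fst (𝕜 := ℝ) (p := α t)).comp_hasDerivAt t (hα t ht)
    exact this
  have h2 (t) (ht : t ∈ Ioo (t₁ - ε) (t₁ + ε)) : HasDerivAt (fun s ↦ (α s).2)
      ((α t).2.2, 6 * (α t).2.1 ^ 2 + (α t).1) t := by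
    have := (hasFDerivAt_snd (𝕜 := ℝ) (p := α t)).comp_hasDerivAt t (hα t ht)
    exact this
  -- The first component has derivative `1` and starts at `t₁`, so it is the time variable.
  have htime : EqOn (fun s ↦ (α s).1) id (Ioo (t₁ - ε) (t₁ + ε)) := by
    refine isOpen_Ioo.eqOn_of_deriv_eq isPreconnected_Ioo
      (fun t ht ↦ (h1 t ht).differentiableAt.differentiableWithinAt) differentiableOn_id
      (fun t ht ↦ by rw [(h1 t ht).deriv, deriv_id]) (x := t₁) ⟨by linarith, by linarith⟩ ?_
    simp [h₀]
  refine ⟨ε, hε, fun s ↦ (α s).2.1, fun s ↦ (α s).2.2, by simp [h₀], by simp [h₀], fun t ht ↦ ?_⟩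
  have htt : (α t).1 = t := htime ht
  have h3 := (hasFDerivAt_fst (𝕜 := ℝ) (p := (α t).2)).comp_hasDerivAt t (h2 t ht)
  have h4 := (hasFDerivAt_snd (𝕜 := ℝ) (p := (α t).2)).comp_hasDerivAt t (h2 t ht)
  rw [htt] at h4
  exact ⟨h3, h4⟩

lemma exists_isPainleveOnePair (t₀ u₀ v₀ : ℝ) :
    ∃ T > t₀, ∃ u v : ℝ → ℝ, u t₀ = u₀ ∧ v t₀ = v₀ ∧ IsPainleveOnePair t₀ T u v := by
  obtain ⟨ε, hε, u, v, hu, hv, h⟩ := exists_painleveOne_local t₀ u₀ v₀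
  refine ⟨t₀ + ε, by linarith, u, v, hu, hv, fun t ht ↦ ?_⟩
  have := h t ⟨by linarith [ht.1], ht.2⟩
  exact ⟨this.1.hasDerivWithinAt, this.2.hasDerivWithinAt⟩

/-! ### Continuation and the maximal solution -/

/-- Functions glued at `b` have a two-sided derivative there if their values and their one-sided
derivatives match. -/
lemma hasDerivAt_ite_lt {f f' g : ℝ → ℝ} {a b d : ℝ} (hab : a < b)
    (hf : ∀ t ∈ Ioo a b, HasDerivAt f (f' t) t) (hlim : Tendsto f (𝓝[<] b) (𝓝 (g b)))
    (hlim' : Tendsto f' (𝓝[<] b) (𝓝 d)) (hg : HasDerivAt g d b) :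
    HasDerivAt (fun t ↦ if t < b then f t else g t) d b := by
  set F : ℝ → ℝ := fun t ↦ if t < b then f t else g t
  have hF : ∀ t < b, F =ᶠ[𝓝 t] f := fun t ht ↦ by
    filter_upwards [Iio_mem_nhds ht] with s hs using if_pos hs
  have hder : ∀ t ∈ Ioo a b, HasDerivAt F (f' t) t := fun t ht ↦
    (hf t ht).congr_of_eventuallyEq (hF t ht.2)
  have hFb : F b = g b := if_neg (lt_irrefl b)
  have hmem : Ioo a b ∈ 𝓝[<] b := Ioo_mem_nhdsLT hab
  have hleft : HasDerivWithinAt F d (Iic b) b := by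
    refine hasDerivWithinAt_Iic_of_tendsto_deriv (s := Ioo a b)
      (fun t ht ↦ (hder t ht).differentiableAt.differentiableWithinAt) ?_ hmem ?_
    · rw [ContinuousWithinAt, hFb]
      refine (hlim.mono_left (nhdsWithin_mono b fun t ht ↦ ht.2)).congr' ?_
      filter_upwards [self_mem_nhdsWithin] with s hs using (if_pos hs.2).symm
    · refine hlim'.congr' ?_
      filter_upwards [hmem] with s hs using (hder s hs).deriv.symm
  have hright : HasDerivWithinAt F d (Ici b) b :=
    hg.hasDerivWithinAt.congr (fun s hs ↦ if_neg (not_lt.2 hs)) hFb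
  simpa [Iic_union_Ici] using hleft.union hright

namespace IsPainleveOnePair

variable {a b : ℝ} {u v : ℝ → ℝ}

/-- A solution on `[a, b)` that has finite limits at `b` can be continued past `b`. -/
lemma exists_extension (h : IsPainleveOnePair a b u v) (hab : a < b) {U V : ℝ}
    (hU : Tendsto u (𝓝[<] b) (𝓝 U)) (hV : Tendsto v (𝓝[<] b) (𝓝 V)) :
    ∃ c > b, ∃ w z : ℝ → ℝ, w a = u a ∧ z a = v a ∧ IsPainleveOnePair a c w z := by
  obtain ⟨ε, hε, w, z, hw, hz, hwz⟩ := exists_painleveOne_local b U V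
  refine ⟨b + ε, by linarith, fun t ↦ if t < b then u t else w t,
    fun t ↦ if t < b then v t else z t, if_pos hab, if_pos hab, fun t ht ↦ ?_⟩
  rcases lt_trichotomy t b with htb | rfl | htb
  · have hmem : Ico a b ∈ 𝓝[Ico a (b + ε)] t := by
      filter_upwards [self_mem_nhdsWithin, mem_nhdsWithin_of_mem_nhds (Iio_mem_nhds htb)]
        with s hs hs' using ⟨hs.1, hs'⟩
    have hev (f g : ℝ → ℝ) :
        (fun t ↦ if t < b then f t else g t) =ᶠ[𝓝[Ico a (b + ε)] t] f := by
      filter_upwards [mem_nhdsWithin_of_mem_nhds (Iio_mem_nhds htb)] with s hs using if_pos hs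
    have ht' := h t ⟨ht.1, htb⟩
    simp only [if_pos htb]
    exact ⟨(ht'.1.mono_of_mem_nhdsWithin hmem).congr_of_eventuallyEq (hev u w) (if_pos htb),
      (ht'.2.mono_of_mem_nhdsWithin hmem).congr_of_eventuallyEq (hev v z) (if_pos htb)⟩
  · have ht' := hwz t ⟨by linarith, by linarith⟩
    simp only [lt_irrefl, if_false]
    refine ⟨(hasDerivAt_ite_lt hab (fun s hs ↦ (h.hasDerivAt hs).1) (hw ▸ hU) ?_
        ht'.1).hasDerivWithinAt,
      (hasDerivAt_ite_lt hab (fun s hs ↦ (h.hasDerivAt hs).2) (hz ▸ hV) ?_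
        ht'.2).hasDerivWithinAt⟩
    · exact hz ▸ hV
    · rw [hw]
      exact ((hU.pow 2).const_mul 6).add (tendsto_id.mono_left nhdsWithin_le_nhds)
  · have hev (f g : ℝ → ℝ) : (fun t ↦ if t < b then f t else g t) =ᶠ[𝓝 t] g := by
      filter_upwards [Ioi_mem_nhds htb] with s hs using if_neg (not_lt.2 (le_of_lt hs))
    have ht' := hwz t ⟨by linarith, ht.2⟩
    simp only [if_neg (not_lt.2 htb.le)]
    exact ⟨(ht'.1.congr_of_eventuallyEq (hev u w)).hasDerivWithinAt,
      (ht'.2.congr_of_eventuallyEq (hev v z)).hasDerivWithinAt⟩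

/-- Being a solution is a local property, so it passes to increasing unions of intervals. -/
lemma of_forall_lt (h : ∀ t ∈ Ico a b, ∃ c > t, IsPainleveOnePair a c u v) :
    IsPainleveOnePair a b u v := by
  intro t ht
  obtain ⟨c, hc, hsol⟩ := h t ht
  have hmem : Ico a c ∈ 𝓝[Ico a b] t := by
    filter_upwards [self_mem_nhdsWithin, mem_nhdsWithin_of_mem_nhds (Iio_mem_nhds hc)]
      with s hs hs' using ⟨hs.1, hs'⟩
  have ht' := hsol t ⟨ht.1, hc⟩
  exact ⟨ht'.1.mono_of_mem_nhdsWithin hmem, ht'.2.mono_of_mem_nhdsWithin hmem⟩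

lemma congr {w z : ℝ → ℝ} (h : IsPainleveOnePair a b u v)
    (hw : ∀ t ∈ Ico a b, w t = u t ∧ z t = v t) : IsPainleveOnePair a b w z := by
  intro t ht
  rw [(hw t ht).1, (hw t ht).2]
  exact ⟨(h t ht).1.congr (fun s hs ↦ (hw s hs).1) (hw t ht).1,
    (h t ht).2.congr (fun s hs ↦ (hw s hs).2) (hw t ht).2⟩

end IsPainleveOnePair

/-- All solutions of one initial value problem are restrictions of a single pair of functions. -/
lemma exists_common_painleveOnePair (t₀ u₀ v₀ : ℝ) :
    ∃ u v : ℝ → ℝ, u t₀ = u₀ ∧ v t₀ = v₀ ∧ ∀ (T : ℝ) (w z : ℝ → ℝ), w t₀ = u₀ → z t₀ = v₀ →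
      IsPainleveOnePair t₀ T w z →
        IsPainleveOnePair t₀ T u v ∧ ∀ t ∈ Ico t₀ T, w t = u t ∧ z t = v t := by
  classical
  have hex : ∀ t : ℝ, ∃ p : ℝ × ℝ, ∀ (T : ℝ) (w z : ℝ → ℝ), w t₀ = u₀ → z t₀ = v₀ →
      IsPainleveOnePair t₀ T w z → t ∈ Ico t₀ T → w t = p.1 ∧ z t = p.2 := by
    intro t
    by_cases h : ∃ (T : ℝ) (w z : ℝ → ℝ), w t₀ = u₀ ∧ z t₀ = v₀ ∧
      IsPainleveOnePair t₀ T w z ∧ t ∈ Ico t₀ T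
    · obtain ⟨T, w, z, hw, hz, hwz, ht⟩ := h
      refine ⟨(w t, z t), fun T' w' z' hw' hz' hwz' ht' ↦ ?_⟩
      exact (hwz'.mono (min_le_right T T')).eqOn (hwz.mono (min_le_left T T'))
        (hw'.trans hw.symm) (hz'.trans hz.symm) t ⟨ht.1, lt_min ht.2 ht'.2⟩
    · exact ⟨0, fun T w z hw hz hwz ht ↦ (h ⟨T, w, z, hw, hz, hwz, ht⟩).elim⟩
  choose p hp using hex
  have hval : ∀ (T : ℝ) (w z : ℝ → ℝ), w t₀ = u₀ → z t₀ = v₀ → IsPainleveOnePair t₀ T w z →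
      ∀ t ∈ Ico t₀ T, w t = (p t).1 ∧ z t = (p t).2 :=
    fun T w z hw hz hwz t ht ↦ hp t T w z hw hz hwz ht
  obtain ⟨T, hT, w, z, hw, hz, hwz⟩ := exists_isPainleveOnePair t₀ u₀ v₀
  have h₀ := hval T w z hw hz hwz t₀ ⟨le_rfl, hT⟩
  refine ⟨fun t ↦ (p t).1, fun t ↦ (p t).2, h₀.1.symm.trans hw, h₀.2.symm.trans hz,
    fun T w z hw hz hwz ↦ ⟨?_, hval T w z hw hz hwz⟩⟩
  exact hwz.congr fun t ht ↦
    ⟨(hval T w z hw hz hwz t ht).1.symm, (hval T w z hw hz hwz t ht).2.symm⟩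

/-! ### Growth of functions with one-sided derivative bounds -/

lemma image_sub_le_of_hasDerivAt_le {f f' : ℝ → ℝ} {a b K : ℝ}
    (hf : ∀ t ∈ Ioo a b, HasDerivAt f (f' t) t) (hK : ∀ t ∈ Ioo a b, f' t ≤ K) :
    ∀ s ∈ Ioo a b, ∀ t ∈ Ioo a b, s ≤ t → f t - f s ≤ K * (t - s) := by
  refine (convex_Ioo a b).image_sub_le_mul_sub_of_deriv_le
    (fun t ht ↦ (hf t ht).continuousAt.continuousWithinAt) ?_ ?_ <;> rw [interior_Ioo]
  · exact fun t ht ↦ (hf t ht).differentiableAt.differentiableWithinAt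
  · exact fun t ht ↦ (hf t ht).deriv ▸ hK t ht

lemma le_image_sub_of_le_hasDerivAt {f f' : ℝ → ℝ} {a b m : ℝ}
    (hf : ∀ t ∈ Ioo a b, HasDerivAt f (f' t) t) (hm : ∀ t ∈ Ioo a b, m ≤ f' t) :
    ∀ s ∈ Ioo a b, ∀ t ∈ Ioo a b, s ≤ t → m * (t - s) ≤ f t - f s := by
  intro s hs t ht hst
  have := image_sub_le_of_hasDerivAt_le (f := fun t ↦ -f t) (f' := fun t ↦ -f' t) (K := -m)
    (fun t ht ↦ (hf t ht).neg) (fun t ht ↦ neg_le_neg (hm t ht)) s hs t ht hst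
  linarith

/-- A function whose derivative is bounded below on `(a, b)` has a limit at `b`, finite or `+∞`:
up to a linear term it is monotone. -/
lemma tendsto_atTop_or_nhds_of_le_deriv {f f' : ℝ → ℝ} {a b m : ℝ} (hab : a < b)
    (hf : ∀ t ∈ Ioo a b, HasDerivAt f (f' t) t) (hm : ∀ t ∈ Ioo a b, m ≤ f' t) :
    Tendsto f (𝓝[<] b) atTop ∨ ∃ L, Tendsto f (𝓝[<] b) (𝓝 L) := by
  have hmono : MonotoneOn (fun t ↦ f t - m * t) (Ioo a b) := fun s hs t ht hst ↦ by
    have := le_image_sub_of_le_hasDerivAt hf hm s hs t ht hst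
    simp only
    linarith
  have hlin : Tendsto (fun t : ℝ ↦ m * t) (𝓝[<] b) (𝓝 (m * b)) :=
    (continuous_const.mul continuous_id).continuousWithinAt
  by_cases hbdd : BddAbove ((fun t ↦ f t - m * t) '' Ioo a b)
  · right
    refine ⟨_, ((hmono.tendsto_nhdsWithin_Ioo_left (nonempty_Ioo.2 hab) hbdd).add hlin).congr ?_⟩
    exact fun t ↦ by ring
  · left
    have htop : Tendsto (fun t ↦ f t - m * t) (𝓝[<] b) atTop := by
      refine tendsto_atTop.2 fun C ↦ ?_
      obtain ⟨_, ⟨s, hs, rfl⟩, hCs⟩ := not_bddAbove_iff.1 hbdd C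
      filter_upwards [Ioo_mem_nhdsLT hs.2] with t ht
      exact hCs.le.trans (hmono hs ⟨hs.1.trans ht.1, ht.2⟩ ht.1.le)
    exact (tendsto_atTop_add_right_of_le' _ (m * b - 1) htop
      (hlin.eventually (eventually_ge_nhds (by linarith)))).congr fun t ↦ by ring

lemma not_tendsto_atTop_of_deriv_le {f f' : ℝ → ℝ} {a b K : ℝ} (hab : a < b)
    (hf : ∀ t ∈ Ioo a b, HasDerivAt f (f' t) t) (hK : ∀ t ∈ Ioo a b, f' t ≤ K) :
    ¬ Tendsto f (𝓝[<] b) atTop := by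
  intro htop
  obtain ⟨s, hs⟩ := nonempty_Ioo.2 hab
  obtain ⟨t, ht, hst⟩ := ((htop.eventually_gt_atTop (f s + |K| * (b - a))).and
    (Ioo_mem_nhdsLT hs.2)).exists
  have h₁ := image_sub_le_of_hasDerivAt_le hf hK s hs t ⟨hs.1.trans hst.1, hst.2⟩ hst.1.le
  have h₂ : K * (t - s) ≤ |K| * (b - a) :=
    mul_le_mul (le_abs_self K) (by linarith [hst.2, hs.1]) (by linarith [hst.1]) (abs_nonneg K)
  linarith

lemma tendsto_atTop_of_pos_le_deriv {f f' : ℝ → ℝ} {a c : ℝ} (hc : 0 < c)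
    (hf : ∀ t > a, HasDerivAt f (f' t) t) (hf' : ∀ t > a, c ≤ f' t) : Tendsto f atTop atTop := by
  have hlow : Tendsto (fun t ↦ f (a + 1) + c * (t - (a + 1))) atTop atTop :=
    tendsto_atTop_add_const_left _ _
      ((tendsto_atTop_add_const_right _ _ tendsto_id).const_mul_atTop hc)
  refine tendsto_atTop_mono' _ ?_ hlow
  filter_upwards [eventually_ge_atTop (a + 1)] with t ht
  have := le_image_sub_of_le_hasDerivAt (b := t + 1) (fun s hs ↦ hf s hs.1)
    (fun s hs ↦ hf' s hs.1) (a + 1) ⟨by linarith, by linarith⟩ t ⟨by linarith, by linarith⟩ ht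
  linarith

/-! ### Blow-up in finite time -/

lemma hasDerivAt_painleveOne_energy {u v : ℝ → ℝ} {t : ℝ} (hu : HasDerivAt u (v t) t)
    (hv : HasDerivAt v (6 * u t ^ 2 + t) t) :
    HasDerivAt (fun s ↦ v s ^ 2 - 4 * u s ^ 3) (2 * t * v t) t := by
  refine ((hv.pow 2).sub ((hu.pow 3).const_mul 4)).congr_deriv ?_
  norm_num
  ring

lemma hasDerivAt_inv_sqrt {u : ℝ → ℝ} {t d : ℝ} (hu : HasDerivAt u d t) (hpos : 0 < u t) :
    HasDerivAt (fun s ↦ (√(u s))⁻¹) (-(d / (2 * (u t * √(u t))))) t := by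
  have hs : 0 < √(u t) := Real.sqrt_pos.2 hpos
  refine ((hu.sqrt hpos.ne').inv hs.ne').congr_deriv ?_
  rw [Real.sq_sqrt hpos.le]
  field_simp

/-- No solution exists for all forward time: since `u'' ≥ t`, both `u` and `u'` would tend to
`+∞`, then `u'² ≥ u³` because the energy `u'² - 4 u³` is nondecreasing, and `u^(-1/2)` would
decrease at a rate at least `1/2` forever while remaining positive. -/
lemma not_forall_isPainleveOnePair {a : ℝ} {u v : ℝ → ℝ}
    (h : ∀ T, IsPainleveOnePair a T u v) : False := by
  have hd : ∀ t > a, HasDerivAt u (v t) t ∧ HasDerivAt v (6 * u t ^ 2 + t) t :=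
    fun t ht ↦ (h (t + 1)).hasDerivAt ⟨ht, by linarith⟩
  have hvtop : Tendsto v atTop atTop := by
    refine tendsto_atTop_of_pos_le_deriv (a := max a 1) one_pos
      (fun t ht ↦ (hd t ((le_max_left _ _).trans_lt ht)).2) fun t ht ↦ ?_
    nlinarith [sq_nonneg (u t), (le_max_right a 1).trans_lt ht]
  obtain ⟨b, hb⟩ := eventually_atTop.1
    ((hvtop.eventually_ge_atTop 1).and (eventually_gt_atTop (max a 0)))
  have hba : ∀ t > b, t > a := fun t ht ↦ (le_max_left _ _).trans_lt (hb t (le_of_lt ht)).2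
  have hb0 : ∀ t > b, 0 < t := fun t ht ↦ (le_max_right _ _).trans_lt (hb t (le_of_lt ht)).2
  have hutop : Tendsto u atTop atTop := tendsto_atTop_of_pos_le_deriv one_pos
    (fun t ht ↦ (hd t (hba t ht)).1) (fun t ht ↦ (hb t (le_of_lt ht)).1)
  set E := v (b + 1) ^ 2 - 4 * u (b + 1) ^ 3
  have hE : ∀ t ≥ b + 1, E ≤ v t ^ 2 - 4 * u t ^ 3 := by
    intro t ht
    have := le_image_sub_of_le_hasDerivAt (b := t + 1) (m := 0)
      (fun s (hs : s ∈ Ioo b (t + 1)) ↦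
        hasDerivAt_painleveOne_energy (hd s (hba s hs.1)).1 (hd s (hba s hs.1)).2)
      (fun s hs ↦ mul_nonneg (mul_nonneg two_pos.le (hb0 s hs.1).le)
        (zero_le_one.trans (hb s hs.1.le).1))
      (b + 1) ⟨by linarith, by linarith⟩ t ⟨by linarith, by linarith⟩ ht
    linarith
  obtain ⟨c, hc⟩ := eventually_atTop.1
    ((hutop.eventually_ge_atTop (max 1 (-E))).and (eventually_gt_atTop (b + 1)))
  have key : Tendsto (fun t ↦ -(√(u t))⁻¹) atTop atTop := by
    refine tendsto_atTop_of_pos_le_deriv (a := c) (c := 1 / 2) (by norm_num)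
      (fun t ht ↦ (hasDerivAt_inv_sqrt (hd t (hba t ?_)).1 ?_).neg) fun t ht ↦ ?_
    · linarith [(hc t (le_of_lt ht)).2]
    · linarith [(le_max_left _ _).trans (hc t (le_of_lt ht)).1]
    obtain ⟨hut, htb⟩ := hc t (le_of_lt ht)
    have hu1 : 1 ≤ u t := (le_max_left _ _).trans hut
    have huE : -E ≤ u t := (le_max_right _ _).trans hut
    have hv0 : 0 ≤ v t := zero_le_one.trans (hb t (by linarith)).1
    have hcube : u t ≤ u t ^ 3 := le_self_pow₀ hu1 (by norm_num)
    have hs : 0 < √(u t) := Real.sqrt_pos.2 (by linarith)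
    have hle : u t * √(u t) ≤ v t := by
      refine abs_le_of_sq_le_sq' ?_ hv0 |>.2
      rw [mul_pow, Real.sq_sqrt (by linarith)]
      linarith [hE t htb.le]
    rw [neg_neg, le_div_iff₀ (by positivity)]
    linarith
  obtain ⟨t, ht⟩ := (key.eventually_gt_atTop 0).exists
  have : 0 ≤ (√(u t))⁻¹ := by positivity
  linarith

namespace IsPainleveOnePair

variable {a b : ℝ} {u v : ℝ → ℝ}

/-- At a finite end point past which the solution cannot be continued, `u` and `u'` tend to `+∞`.
Both have a limit in `(-∞, +∞]` because `u''` is bounded below; one of the limits being finite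
forces the other one to be finite, and then the solution can be continued. -/
lemma tendsto_atTop_of_not_extension (h : IsPainleveOnePair a b u v) (hab : a < b)
    (hmax : ∀ c > b, ∀ w z : ℝ → ℝ, w a = u a → z a = v a → ¬ IsPainleveOnePair a c w z) :
    Tendsto u (𝓝[<] b) atTop ∧ Tendsto v (𝓝[<] b) atTop := by
  have hno : ∀ U V, Tendsto u (𝓝[<] b) (𝓝 U) → ¬ Tendsto v (𝓝[<] b) (𝓝 V) := by
    intro U V hU hV
    obtain ⟨c, hc, w, z, hw, hz, hwz⟩ := h.exists_extension hab hU hV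
    exact hmax c hc w z hw hz hwz
  have hev {p : ℝ → Prop} (hp : ∀ᶠ t in 𝓝[<] b, p t) :
      ∃ s, s < b ∧ a ≤ s ∧ ∀ t ∈ Ioo s b, p t := by
    obtain ⟨s, hs, hsp⟩ := (mem_nhdsLT_iff_exists_Ioo_subset' hab).1 hp
    exact ⟨max a s, max_lt hab hs, le_max_left _ _,
      fun t ht ↦ hsp ⟨(le_max_right _ _).trans_lt ht.1, ht.2⟩⟩
  have hv : Tendsto v (𝓝[<] b) atTop := by
    refine (tendsto_atTop_or_nhds_of_le_deriv (m := a) hab (fun t ht ↦ (h.hasDerivAt ht).2)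
      fun t ht ↦ ?_).resolve_right ?_
    · nlinarith [sq_nonneg (u t), ht.1]
    rintro ⟨V, hV⟩
    obtain ⟨s, hsb, has, hs⟩ := hev ((hV.eventually (eventually_ge_nhds (sub_one_lt V))).and
      (hV.eventually (eventually_le_nhds (lt_add_one V))))
    have hd : ∀ t ∈ Ioo s b, HasDerivAt u (v t) t :=
      fun t ht ↦ (h.hasDerivAt ⟨has.trans_lt ht.1, ht.2⟩).1
    rcases tendsto_atTop_or_nhds_of_le_deriv hsb hd (fun t ht ↦ (hs t ht).1) with htop | ⟨U, hU⟩
    · exact not_tendsto_atTop_of_deriv_le hsb hd (fun t ht ↦ (hs t ht).2) htop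
    · exact hno U V hU hV
  refine ⟨?_, hv⟩
  obtain ⟨s, hsb, has, hs⟩ := hev (hv.eventually_ge_atTop 0)
  refine (tendsto_atTop_or_nhds_of_le_deriv hsb
    (fun t ht ↦ (h.hasDerivAt ⟨has.trans_lt ht.1, ht.2⟩).1) hs).resolve_right ?_
  rintro ⟨U, hU⟩
  have hlim : Tendsto (fun t ↦ 6 * u t ^ 2 + t) (𝓝[<] b) (𝓝 (6 * U ^ 2 + b)) :=
    ((hU.pow 2).const_mul 6).add (tendsto_id.mono_left nhdsWithin_le_nhds)
  obtain ⟨r, hrb, har, hr⟩ := hev (hlim.eventually (eventually_le_nhds (lt_add_one _)))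
  exact not_tendsto_atTop_of_deriv_le hrb
    (fun t ht ↦ (h.hasDerivAt ⟨har.trans_lt ht.1, ht.2⟩).2) hr hv

/-! ### The blow-up rate -/

/-- The energy `E = u'² - 4 u³` satisfies `|E'| = |2 t u'| ≤ 2 M u'` near the blow-up time, so it
grows at most linearly in `u` and is negligible against `u³`. -/
lemma tendsto_sq_deriv_div_cube (h : IsPainleveOnePair a b u v) (hab : a < b)
    (hu : Tendsto u (𝓝[<] b) atTop) (hv : Tendsto v (𝓝[<] b) atTop) :
    Tendsto (fun t ↦ v t ^ 2 / u t ^ 3) (𝓝[<] b) (𝓝 4) := by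
  obtain ⟨s₀, hs₀, hsv⟩ := (mem_nhdsLT_iff_exists_Ioo_subset' hab).1 (hv.eventually_ge_atTop 0)
  set s := max a s₀
  have hsb : s < b := max_lt hab hs₀
  have hd : ∀ t ∈ Ioo s b, HasDerivAt u (v t) t ∧ HasDerivAt v (6 * u t ^ 2 + t) t :=
    fun t ht ↦ h.hasDerivAt ⟨(le_max_left _ _).trans_lt ht.1, ht.2⟩
  have hv0 : ∀ t ∈ Ioo s b, 0 ≤ v t := fun t ht ↦ hsv ⟨(le_max_right _ _).trans_lt ht.1, ht.2⟩
  set M := max |a| |b|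
  have hM : ∀ t ∈ Ioo s b, |t| ≤ M := fun t ht ↦
    abs_le_max_abs_abs ((le_max_left _ _).trans ht.1.le) ht.2.le
  set E : ℝ → ℝ := fun t ↦ v t ^ 2 - 4 * u t ^ 3
  have hE : ∀ t ∈ Ioo s b, HasDerivAt E (2 * t * v t) t :=
    fun t ht ↦ hasDerivAt_painleveOne_energy (hd t ht).1 (hd t ht).2
  obtain ⟨r, hr⟩ := nonempty_Ioo.2 hsb
  have hbound : ∀ t ∈ Ioo r b, |E t| ≤ 2 * M * u t + (|E r| + |2 * M * u r|) := by
    intro t ht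
    have ht' : t ∈ Ioo s b := ⟨hr.1.trans ht.1, ht.2⟩
    have h₁ := le_image_sub_of_le_hasDerivAt (m := 0)
      (fun t ht ↦ (hE t ht).add ((hd t ht).1.const_mul (2 * M)))
      (fun t ht ↦ by nlinarith [hv0 t ht, (abs_le.1 (hM t ht)).1]) r hr t ht' ht.1.le
    have h₂ := le_image_sub_of_le_hasDerivAt (m := 0)
      (fun t ht ↦ ((hd t ht).1.const_mul (2 * M)).sub (hE t ht))
      (fun t ht ↦ by nlinarith [hv0 t ht, (abs_le.1 (hM t ht)).2]) r hr t ht' ht.1.le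
    simp only [Pi.add_apply, Pi.sub_apply] at h₁ h₂
    have h₃ := abs_le.1 (le_refl |E r|)
    have h₄ := abs_le.1 (le_refl |2 * M * u r|)
    exact abs_le.2 ⟨by linarith, by linarith⟩
  set C := |E r| + |2 * M * u r|
  have hinv : Tendsto (fun t ↦ (u t)⁻¹) (𝓝[<] b) (𝓝 0) := tendsto_inv_atTop_zero.comp hu
  have hbd0 : Tendsto (fun t ↦ 2 * M * (u t)⁻¹ ^ 2 + C * (u t)⁻¹ ^ 3) (𝓝[<] b) (𝓝 0) := by
    simpa using ((hinv.pow 2).const_mul (2 * M)).add ((hinv.pow 3).const_mul C)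
  have hE0 : Tendsto (fun t ↦ E t / u t ^ 3) (𝓝[<] b) (𝓝 0) := by
    refine squeeze_zero_norm' ?_ hbd0
    filter_upwards [hu.eventually_gt_atTop 0, Ioo_mem_nhdsLT hr.2] with t ht0 ht
    rw [Real.norm_eq_abs, abs_div, abs_of_pos (pow_pos ht0 3), div_le_iff₀ (pow_pos ht0 3)]
    refine (hbound t ht).trans_eq ?_
    field_simp
  have hsum := hE0.add_const 4
  rw [zero_add] at hsum
  refine hsum.congr' ?_
  filter_upwards [hu.eventually_gt_atTop 0] with t ht0
  simp only [E]
  field_simp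
  ring

/-- The function `u^(-1/2)` vanishes at the blow-up time with left derivative `-1`. -/
lemma isEquivalent_of_tendsto_atTop (h : IsPainleveOnePair a b u v) (hab : a < b)
    (hu : Tendsto u (𝓝[<] b) atTop) (hv : Tendsto v (𝓝[<] b) atTop) :
    u ~[𝓝[<] b] (fun t ↦ (b - t) ^ (-2 : ℤ)) := by
  have hquot : Tendsto (fun t ↦ v t / (2 * (u t * √(u t)))) (𝓝[<] b) (𝓝 1) := by
    have h₁ := (h.tendsto_sq_deriv_div_cube hab hu hv).sqrt.div_const 2
    have h₂ : √4 / 2 = (1 : ℝ) := by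
      rw [show (4 : ℝ) = 2 ^ 2 by norm_num, Real.sqrt_sq two_pos.le, div_self two_ne_zero]
    rw [h₂] at h₁
    refine h₁.congr' ?_
    filter_upwards [hu.eventually_gt_atTop 0, hv.eventually_gt_atTop 0] with t ht hvt
    rw [Real.sqrt_div (sq_nonneg _), Real.sqrt_sq hvt.le, pow_succ,
      Real.sqrt_mul (sq_nonneg _), Real.sqrt_sq ht.le, div_div, mul_comm _ (2 : ℝ)]
  have hratio : Tendsto (fun t ↦ (√(u t))⁻¹ / (b - t)) (𝓝[<] b) (𝓝 1) := by
    refine HasDerivAt.lhopital_zero_nhdsLT (f' := fun t ↦ -(v t / (2 * (u t * √(u t)))))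
      (g' := fun _ ↦ -1) ?_ ?_ ?_ ?_ ?_ ?_
    · filter_upwards [hu.eventually_gt_atTop 0, Ioo_mem_nhdsLT hab] with t ht0 ht
      exact hasDerivAt_inv_sqrt (h.hasDerivAt ht).1 ht0
    · exact Eventually.of_forall fun t ↦ (hasDerivAt_id t).const_sub b
    · exact Eventually.of_forall fun _ ↦ by norm_num
    · exact tendsto_inv_atTop_zero.comp (Real.tendsto_sqrt_atTop.comp hu)
    · have : Tendsto (fun t ↦ b - t) (𝓝[<] b) (𝓝 (b - b)) :=
        (continuous_const.sub continuous_id).continuousWithinAt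
      rwa [sub_self] at this
    · simpa using hquot
  refine isEquivalent_of_tendsto_one ?_
  have hsq := (hratio.inv₀ one_ne_zero).pow 2
  rw [inv_one, one_pow] at hsq
  refine hsq.congr' ?_
  filter_upwards [hu.eventually_gt_atTop 0] with t ht0
  rw [Pi.div_apply, zpow_neg, div_inv_eq_mul, inv_div, div_inv_eq_mul, mul_pow,
    Real.sq_sqrt ht0.le, mul_comm]
  norm_cast

end IsPainleveOnePair

/-! ### The maximal solution -/

/-- The maximal solution exists on a bounded interval, ends with `u, u' → +∞`, and has the rate
stated, whatever the initial data. -/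
lemma exists_maximal_painleveOne (t₀ u₀ v₀ : ℝ) :
    ∃ (tmax : ℝ) (u : ℝ → ℝ), IsMaximalPainleveOneSolution t₀ u₀ v₀ tmax u ∧
      Tendsto u (𝓝[<] tmax) atTop ∧ u ~[𝓝[<] tmax] (fun t ↦ (tmax - t) ^ (-2 : ℤ)) := by
  obtain ⟨u, v, hu₀, hv₀, hcommon⟩ := exists_common_painleveOnePair t₀ u₀ v₀
  set S : Set ℝ := {T | IsPainleveOnePair t₀ T u v}
  have hlower : ∀ {T T'}, T ∈ S → T' ≤ T → T' ∈ S := fun hT hT' ↦ hT.mono hT'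
  obtain ⟨T₁, hT₁, w₁, z₁, hw₁, hz₁, hsol₁⟩ := exists_isPainleveOnePair t₀ u₀ v₀
  have hT₁S : T₁ ∈ S := (hcommon T₁ w₁ z₁ hw₁ hz₁ hsol₁).1
  have hbdd : BddAbove S := by
    by_contra hS
    refine not_forall_isPainleveOnePair (a := t₀) (u := u) (v := v) fun T ↦ ?_
    obtain ⟨T', hT', hTT'⟩ := not_bddAbove_iff.1 hS T
    exact hlower hT' hTT'.le
  set b := sSup S
  have hab : t₀ < b := hT₁.trans_le (le_csSup hbdd hT₁S)
  have hsol : IsPainleveOnePair t₀ b u v := IsPainleveOnePair.of_forall_lt fun t ht ↦ by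
    obtain ⟨c, hc, htc⟩ := exists_lt_of_lt_csSup ⟨T₁, hT₁S⟩ ht.2
    exact ⟨c, htc, hc⟩
  have hle : ∀ (T : ℝ) (w z : ℝ → ℝ), w t₀ = u₀ → z t₀ = v₀ → IsPainleveOnePair t₀ T w z → T ≤ b :=
    fun T w z hw hz hwz ↦ le_csSup hbdd (hcommon T w z hw hz hwz).1
  obtain ⟨hutop, hvtop⟩ := hsol.tendsto_atTop_of_not_extension hab fun c hc w z hw hz hwz ↦
    not_le_of_gt hc (hle c w z (hw.trans hu₀) (hz.trans hv₀) hwz)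
  refine ⟨b, u, ⟨⟨hab, hu₀, v, hv₀, hsol⟩, ?_⟩, hutop,
    hsol.isEquivalent_of_tendsto_atTop hab hutop hvtop⟩
  rintro T w ⟨-, hw, z, hz, hwz⟩
  exact ⟨hle T w z hw hz hwz, fun t ht ↦ ((hcommon T w z hw hz hwz).2 t ht).1⟩

theorem mainTheorem9 :
    ∃ c_u : ℝ, 0 < c_u ∧
      ∀ t₀ : ℝ, ∃ R : ℝ, ∀ u₀ : ℝ, R < u₀ → ∀ v₀ : ℝ,
        ∃ (tmax : ℝ) (u : ℝ → ℝ),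
          IsMaximalPainleveOneSolution t₀ u₀ v₀ tmax u ∧
          Tendsto u (𝓝[<] tmax) atTop ∧
          u ~[𝓝[<] tmax] (fun t => c_u * (tmax - t) ^ (-2 : ℤ)) := by
  refine ⟨1, one_pos, fun t₀ ↦ ⟨0, fun u₀ _ v₀ ↦ ?_⟩⟩
  simpa only [one_mul] using exists_maximal_painleveOne t₀ u₀ v₀
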